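/- For a real number $r>2$ put $$C(r):=\Big\{\big(1-\tfrac1r\big)\sum_{i=0}^{\infty}\frac{a_i}{r^i}\;:\;a_i\in\{0,1\}\text{ for all }i\ge 0\Big\},$$ which is the middle-$\alpha$ Cantor set $C_\alpha\subset[0,1]$ with $\alpha=1-\frac2r$. Let $\gamma:=1.0321$, $p:=\gamma^{40}=3.5389\ldots$, $q:=\gamma^{31}=2.6630\ldots$, $\alpha:=1-\frac2p$, $\beta:=1-\frac2q$, so that $C_\alpha=C(p)$ and $C_\beta=C(q)$. Then for every real $\lambda\neq0$ the arithmetic difference $$C_\alpha-\lambda C_\beta:=\{x-\lambda y\;:\;x\in C_\alpha,\ y\in C_\beta\}$$ contains a nondegenerate interval, i.e. there are real numbers $u<v$ with $[u,v]\subseteq C_\alpha-\lambda C_\beta$. -/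

import Mathlib

open scoped Pointwise

/-- For `p > 2`, the middle-`α` Cantor set `C_α` with `α = 1 - 2 / p`: all sums
`(1 - 1/p) * ∑ aᵢ / pⁱ` with digits `aᵢ ∈ {0, 1}`. (For `p > 2` the series always converges.) -/
noncomputable def middleCantorSet (p : ℝ) : Set ℝ :=
  {x : ℝ | ∃ a : ℕ → ℝ, (∀ i, a i ∈ ({0, 1} : Set ℝ)) ∧
    x = (1 - 1 / p) * ∑' i : ℕ, a i / p ^ i}

/-! ### The Cantor sets -/

/-! As C(q) = 1 - C(q), it suffices to find intervals in S(λ) = C(p) + λC(q) for λ > 0. Splitting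
off a leading digit gives S(λ) = p⁻¹(S(pλ) + {0, p-1}) (a p-step, from pλ to λ) and S(qλ) = S(λ) +
{0, λ(q-1)} (a q-step). As p = γ^40 and q = γ^31, these steps permute the 71 scales μγ^k, -31 ≤ k ≤
39, in a single cycle, and μ may be taken in a window of ratio γ (`exists_Icc_subset_mul_pow`).

Intervals lying within ε of S are carried around the cycle. If they return to the same scale with
error ε/p, iteration and compactness put them inside S(μ).

For the larger μ in the window the two copies overlap at every step, and the whole hull returns
(`full_cycle`). For the smaller μ the p-step at k = -31 may leave a gap. The resulting holes are
followed: overlaps fill some, and the others retreat into a margin at the ends, which p-steps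
shrink. The trimmed interval survives the remaining steps and regenerates the initial pieces
(`holes_cycle`). -/

lemma summable_digits {p : ℝ} (hp : 1 < p) {a : ℕ → ℝ}
    (ha : ∀ i, a i ∈ ({0, 1} : Set ℝ)) : Summable fun i => a i / p ^ i := by
  have hp0 : 0 < p := by linarith
  refine Summable.of_nonneg_of_le (fun i => ?_) (fun i => ?_)
    (summable_geometric_of_lt_one (inv_nonneg.2 hp0.le) (inv_lt_one_of_one_lt₀ hp))
  · rcases ha i with h | h <;> rw [h] <;> positivity
  · rw [inv_pow, ← one_div]
    rcases ha i with h | h <;> rw [h]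
    rw [zero_div]
    positivity

lemma zero_mem_middleCantorSet (p : ℝ) : (0 : ℝ) ∈ middleCantorSet p :=
  ⟨fun _ => 0, fun _ => Or.inl rfl, by simp⟩

lemma cons_mem_middleCantorSet {p x c : ℝ} (hp : 1 < p) (hx : x ∈ middleCantorSet p)
    (hc : c ∈ ({0, 1} : Set ℝ)) : x / p + c * (1 - 1 / p) ∈ middleCantorSet p := by
  obtain ⟨a, ha, rfl⟩ := hx
  have hb : ∀ i, (fun i => Nat.casesOn i c a : ℕ → ℝ) i ∈ ({0, 1} : Set ℝ) := by
    rintro (_ | i)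
    · exact hc
    · exact ha i
  refine ⟨_, hb, ?_⟩
  rw [(summable_digits hp hb).tsum_eq_zero_add]
  have h : ∀ i, a i / p ^ (i + 1) = a i / p ^ i / p := fun i => by rw [pow_succ, div_div]
  simp only [h, tsum_div_const, pow_zero, div_one]
  change _ = (1 - 1 / p) * (c + (∑' i, a i / p ^ i) / p)
  ring

lemma one_sub_mem_middleCantorSet {p x : ℝ} (hp : 1 < p) (hx : x ∈ middleCantorSet p) :
    1 - x ∈ middleCantorSet p := by
  obtain ⟨a, ha, rfl⟩ := hx
  have hp0 : 0 < p := by linarith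
  refine ⟨fun i => 1 - a i, fun i => ?_, ?_⟩
  · rcases ha i with h | (h : a i = 1) <;> simp [h]
  have h1 : Summable fun i : ℕ => (1 : ℝ) / p ^ i :=
    summable_digits hp (a := fun _ => 1) fun _ => Or.inr rfl
  have h2 : ∑' i : ℕ, (1 : ℝ) / p ^ i = (1 - 1 / p)⁻¹ := by
    rw [one_div, ← tsum_geometric_of_lt_one (inv_nonneg.2 hp0.le) (inv_lt_one_of_one_lt₀ hp)]
    simp
  have h3 : (1 - 1 / p) ≠ 0 := by
    have : 1 / p < 1 := (div_lt_one hp0).2 hp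
    linarith
  simp only [sub_div]
  rw [h1.tsum_sub (summable_digits hp ha), h2, mul_sub, mul_inv_cancel₀ h3]

lemma isCompact_middleCantorSet {p : ℝ} (hp : 1 < p) : IsCompact (middleCantorSet p) := by
  have hp0 : 0 < p := by linarith
  have hK : IsCompact (Set.univ.pi fun _ : ℕ => ({0, 1} : Set ℝ)) :=
    isCompact_univ_pi fun _ => (Set.toFinite _).isCompact
  have hc : ContinuousOn (fun a : ℕ → ℝ => (1 - 1 / p) * ∑' i : ℕ, a i / p ^ i)
      (Set.univ.pi fun _ : ℕ => ({0, 1} : Set ℝ)) := by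
    refine continuousOn_const.mul (continuousOn_tsum (u := fun i => p⁻¹ ^ i)
      (fun i => ((continuous_apply i).div_const _).continuousOn)
      (summable_geometric_of_lt_one (inv_nonneg.2 hp0.le) (inv_lt_one_of_one_lt₀ hp)) ?_)
    intro i a ha
    rw [inv_pow, ← one_div]
    rcases ha i trivial with h | h <;> rw [h]
    · simp [hp0.le]
    · rw [Real.norm_of_nonneg (by positivity)]
  convert hK.image_of_continuousOn hc using 1
  ext x
  simp only [middleCantorSet, Set.mem_ofPred_eq, Set.mem_image, Set.mem_univ_pi]
  exact ⟨fun ⟨a, ha, h⟩ => ⟨a, ha, h.symm⟩, fun ⟨a, ha, h⟩ => ⟨a, ha, h.symm⟩⟩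

/-! ### Sums of two Cantor sets and their neighbourhoods -/

/-- The arithmetic sum `C + lam C'` of two middle Cantor sets. -/
def cantorSum (p q lam : ℝ) : Set ℝ := middleCantorSet p + lam • middleCantorSet q

lemma mem_cantorSum {p q lam u : ℝ} : u ∈ cantorSum p q lam ↔
    ∃ x ∈ middleCantorSet p, ∃ y ∈ middleCantorSet q, x + lam * y = u := by
  simp only [cantorSum, Set.mem_add, Set.mem_smul_set, smul_eq_mul]
  constructor
  · rintro ⟨x, hx, _, ⟨y, hy, rfl⟩, h⟩
    exact ⟨x, hx, y, hy, h⟩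
  · rintro ⟨x, hx, y, hy, h⟩
    exact ⟨x, hx, _, ⟨y, hy, rfl⟩, h⟩

/-- The closed `ε`-neighbourhood of `cantorSum p q lam`. -/
def nearSum (p q lam ε : ℝ) : Set ℝ := {u | ∃ w ∈ cantorSum p q lam, |u - w| ≤ ε}

section

variable {p q lam ε u x y z X Y : ℝ}

lemma isClosed_cantorSum (hp : 1 < p) (hq : 1 < q) : IsClosed (cantorSum p q lam) :=
  ((isCompact_middleCantorSet hp).add ((isCompact_middleCantorSet hq).smul lam)).isClosed

lemma mem_nearSum_of_nonneg (hu : 0 ≤ u) (h : u ≤ ε) : u ∈ nearSum p q lam ε :=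
  ⟨0, mem_cantorSum.2 ⟨0, zero_mem_middleCantorSet p, 0, zero_mem_middleCantorSet q, by simp⟩,
    by rw [sub_zero, abs_of_nonneg hu]; exact h⟩

lemma nearSum_div_subset (hp : 1 < p) (h : u ∈ nearSum p q lam (ε / p)) :
    u ∈ nearSum p q lam ε := by
  obtain ⟨w, hw, h'⟩ := h
  have h0 : 0 ≤ ε := by
    have := (abs_nonneg _).trans h'
    rwa [le_div_iff₀ (by linarith), zero_mul] at this
  exact ⟨w, hw, h'.trans (div_le_self h0 hp.le)⟩

lemma mem_cantorSum_of_forall (hp : 1 < p) (hq : 1 < q)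
    (h : ∀ n : ℕ, u ∈ nearSum p q lam (ε / p ^ n)) : u ∈ cantorSum p q lam := by
  rw [← (isClosed_cantorSum hp hq).closure_eq, Metric.mem_closure_iff]
  intro η hη
  obtain ⟨n, hn⟩ := pow_unbounded_of_one_lt (ε / η) hp
  obtain ⟨w, hw, h'⟩ := h n
  refine ⟨w, hw, lt_of_le_of_lt h' ?_⟩
  rw [div_lt_iff₀ hη] at hn
  rw [div_lt_iff₀ (by positivity)]
  linarith

lemma cantorSum_of_first (hp : 1 < p) {c : ℝ} (hc : c ∈ ({0, 1} : Set ℝ))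
    (h : u ∈ cantorSum p q (p * lam)) : (u + c * (p - 1)) / p ∈ cantorSum p q lam := by
  obtain ⟨x, hx, y, hy, rfl⟩ := mem_cantorSum.1 h
  have hp0 : p ≠ 0 := by linarith
  exact mem_cantorSum.2 ⟨_, cons_mem_middleCantorSet hp hx hc, y, hy, by field_simp; ring⟩

lemma cantorSum_of_second (hq : 1 < q) {c : ℝ} (hc : c ∈ ({0, 1} : Set ℝ))
    (h : u ∈ cantorSum p q lam) : u + c * (lam * (q - 1)) ∈ cantorSum p q (q * lam) := by
  obtain ⟨x, hx, y, hy, rfl⟩ := mem_cantorSum.1 h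
  have hq0 : q ≠ 0 := by linarith
  exact mem_cantorSum.2 ⟨x, hx, _, cons_mem_middleCantorSet hq hy hc, by field_simp; ring⟩

lemma nearSum_of_first (hp : 1 < p) {c : ℝ} (hc : c ∈ ({0, 1} : Set ℝ))
    (h : p * u - c * (p - 1) ∈ nearSum p q (p * lam) ε) : u ∈ nearSum p q lam (ε / p) := by
  obtain ⟨w, hw, h'⟩ := h
  have hp0 : 0 < p := by linarith
  refine ⟨_, cantorSum_of_first hp hc hw, ?_⟩
  have : u - (w + c * (p - 1)) / p = (p * u - c * (p - 1) - w) / p := by field_simp; ring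
  rw [this, abs_div, abs_of_pos hp0]
  gcongr

lemma nearSum_of_second (hq : 1 < q) {c : ℝ} (hc : c ∈ ({0, 1} : Set ℝ))
    (h : u - c * (lam * (q - 1)) ∈ nearSum p q lam ε) : u ∈ nearSum p q (q * lam) ε := by
  obtain ⟨w, hw, h'⟩ := h
  refine ⟨_, cantorSum_of_second hq hc hw, ?_⟩
  rwa [sub_sub, add_comm] at h'

lemma nearSum_symm (hp : 1 < p) (hq : 1 < q) (h : 1 + lam - u ∈ nearSum p q lam ε) :
    u ∈ nearSum p q lam ε := by
  obtain ⟨w, hw, h'⟩ := h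
  obtain ⟨x, hx, y, hy, rfl⟩ := mem_cantorSum.1 hw
  refine ⟨_, mem_cantorSum.2 ⟨_, one_sub_mem_middleCantorSet hp hx, _,
    one_sub_mem_middleCantorSet hq hy, rfl⟩, ?_⟩
  rw [← abs_neg]
  convert h' using 2
  ring

/-! ### Intervals in the neighbourhoods -/

lemma Icc_subset_glue {s : Set ℝ} {y' : ℝ} (h₁ : Set.Icc x y ⊆ s) (h₂ : Set.Icc y' z ⊆ s)
    (h : y' ≤ y) : Set.Icc x z ⊆ s := fun u hu => by
  rcases le_total u y with h' | h'
  · exact h₁ ⟨hu.1, h'⟩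
  · exact h₂ ⟨h.trans h', hu.2⟩

lemma Icc_first_low (hp : 1 < p) (h : Set.Icc X Y ⊆ nearSum p q (p * lam) ε)
    (hx : X ≤ p * x) (hy : p * y ≤ Y) : Set.Icc x y ⊆ nearSum p q lam (ε / p) := fun u hu => by
  have h1 := mul_le_mul_of_nonneg_left hu.1 (by linarith : 0 ≤ p)
  have h2 := mul_le_mul_of_nonneg_left hu.2 (by linarith : 0 ≤ p)
  exact nearSum_of_first hp (c := 0) (Or.inl rfl) (h ⟨by linarith, by linarith⟩)

lemma Icc_first_high (hp : 1 < p) (h : Set.Icc X Y ⊆ nearSum p q (p * lam) ε)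
    (hx : X ≤ p * x - (p - 1)) (hy : p * y - (p - 1) ≤ Y) :
    Set.Icc x y ⊆ nearSum p q lam (ε / p) := fun u hu => by
  have h1 := mul_le_mul_of_nonneg_left hu.1 (by linarith : 0 ≤ p)
  have h2 := mul_le_mul_of_nonneg_left hu.2 (by linarith : 0 ≤ p)
  exact nearSum_of_first hp (c := 1) (Or.inr rfl) (h ⟨by linarith, by linarith⟩)

lemma Icc_second_low (hq : 1 < q) (h : Set.Icc X Y ⊆ nearSum p q lam ε)
    (hx : X ≤ x) (hy : y ≤ Y) : Set.Icc x y ⊆ nearSum p q (q * lam) ε := fun u hu =>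
  nearSum_of_second hq (c := 0) (Or.inl rfl)
    (h ⟨by linarith [hu.1], by linarith [hu.2]⟩)

lemma Icc_second_high (hq : 1 < q) (h : Set.Icc X Y ⊆ nearSum p q lam ε)
    (hx : X + lam * (q - 1) ≤ x) (hy : y ≤ Y + lam * (q - 1)) :
    Set.Icc x y ⊆ nearSum p q (q * lam) ε := fun u hu =>
  nearSum_of_second hq (c := 1) (Or.inr rfl)
    (h ⟨by linarith [hu.1], by linarith [hu.2]⟩)

lemma Icc_symm (hp : 1 < p) (hq : 1 < q) (h : Set.Icc X Y ⊆ nearSum p q lam ε)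
    (hx : 1 + lam - Y ≤ x) (hy : y ≤ 1 + lam - X) : Set.Icc x y ⊆ nearSum p q lam ε :=
  fun u hu => nearSum_symm hp hq (h ⟨by linarith [hu.2], by linarith [hu.1]⟩)

/-- An interval reaching past the centre of symmetry can be completed by its mirror image. -/
lemma Icc_symm_glue (hp : 1 < p) (hq : 1 < q) (h : Set.Icc x y ⊆ nearSum p q lam ε)
    (hy : 1 + lam ≤ 2 * y) : Set.Icc x (1 + lam - x) ⊆ nearSum p q lam ε :=
  Icc_subset_glue h (Icc_symm hp hq h le_rfl le_rfl) (by linarith)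

/-- `hov` makes the two trimmed copies overlap. The contraction also divides the margin by `p`,
whereas `trimmed_second` keeps it. -/
lemma trimmed_first {δ δ' : ℝ} (hp : 1 < p)
    (h : Set.Icc δ (1 + p * lam - δ) ⊆ nearSum p q (p * lam) ε) (hδ : δ ≤ p * δ')
    (hov : p - 1 + 2 * δ ≤ 1 + p * lam) :
    Set.Icc δ' (1 + lam - δ') ⊆ nearSum p q lam (ε / p) := by
  have hp0 : p ≠ 0 := by linarith
  refine Icc_subset_glue (y := (1 + p * lam - δ) / p) (y' := (δ + p - 1) / p)
    (Icc_first_low hp h hδ ?_) (Icc_first_high hp h ?_ ?_) ?_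
  · rw [mul_div_cancel₀ _ hp0]
  · rw [mul_div_cancel₀ _ hp0]; linarith
  · linarith
  · gcongr ?_ / p
    linarith

lemma trimmed_second {δ : ℝ} (hq : 1 < q)
    (h : Set.Icc δ (1 + lam - δ) ⊆ nearSum p q lam ε)
    (hov : lam * (q - 1) + 2 * δ ≤ 1 + lam) :
    Set.Icc δ (1 + q * lam - δ) ⊆ nearSum p q (q * lam) ε :=
  Icc_subset_glue (Icc_second_low hq h le_rfl le_rfl)
    (Icc_second_high hq h le_rfl (by linarith)) (by linarith)

end

/-! ### Renormalization along a geometric lattice of scales -/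

/-- The renormalization of the exponent of the scale. -/
def scaleStep (k : ℤ) : ℤ := if k < 0 then k + 40 else k - 31

/-- The orbit of `scaleStep` is traversed backwards. Overlap is hardest at the smallest scale for
p-steps and at the largest for q-steps, so `hl` and `hm` suffice. The gain in `ε` is discarded. -/
lemma trimmed_chain {g p q μ δ ε : ℝ} (hg : 1 < g) (hp : p = g ^ 40) (hq : q = g ^ 31)
    (hμ : 0 < μ) (hδ : 0 ≤ δ) {l m : ℤ}
    (hl : p - 2 + 2 * δ ≤ p * (μ * g ^ l))
    (hm : μ * g ^ m * (q - 2) ≤ q * (1 - 2 * δ)) (hq2 : 2 < q) (n : ℕ) :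
    ∀ k : ℤ, (∀ i < n, l ≤ scaleStep^[i] k ∧ scaleStep^[i] k ≤ m) →
      Set.Icc δ (1 + μ * g ^ scaleStep^[n] k - δ) ⊆ nearSum p q (μ * g ^ scaleStep^[n] k) ε →
      Set.Icc δ (1 + μ * g ^ k - δ) ⊆ nearSum p q (μ * g ^ k) ε := by
  have hg0 : 0 < g := by linarith
  have hp1 : 1 < p := hp ▸ one_lt_pow₀ hg (by norm_num)
  induction n with
  | zero => exact fun k _ h => h
  | succ n ih =>
    intro k hk h
    have h' := ih (scaleStep k) (fun i hi => hk (i + 1) (by omega)) h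
    obtain ⟨h1, h2⟩ := hk 0 (by omega)
    simp only [Function.iterate_zero, id] at h1 h2
    have e1 : g ^ l ≤ g ^ k := zpow_le_zpow_right₀ hg.le h1
    have e2 : g ^ k ≤ g ^ m := zpow_le_zpow_right₀ hg.le h2
    by_cases hk0 : k < 0
    · have e : μ * g ^ scaleStep k = p * (μ * g ^ k) := by
        rw [scaleStep, if_pos hk0, zpow_add₀ hg0.ne', hp]
        norm_cast
        ring
      rw [e] at h'
      have : p * (μ * g ^ l) ≤ p * (μ * g ^ k) := by gcongr
      refine fun u hu => nearSum_div_subset hp1 (trimmed_first hp1 h' ?_ (by linarith) hu)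
      nlinarith
    · have e : μ * g ^ k = q * (μ * g ^ scaleStep k) := by
        rw [scaleStep, if_neg hk0, zpow_sub₀ hg0.ne', hq]
        norm_cast
        field_simp
      have e3 : μ * g ^ k * (q - 2) ≤ μ * g ^ m * (q - 2) := by
        have : 0 ≤ q - 2 := by linarith
        gcongr
      rw [e] at e3 ⊢
      refine trimmed_second (by linarith) h' ?_
      have e4 : q * (μ * g ^ scaleStep k * (q - 2)) ≤ q * (1 - 2 * δ) := by linarith
      have := le_of_mul_le_mul_left e4 (by linarith)
      linarith

/-! ### One renormalization cycle -/

section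

variable {p q μ ε : ℝ}

/-- A scale in the window where both renormalizations leave a small hole: the two outer pieces and
the central piece around the holes reproduce themselves. -/
lemma pieces_of_trimmed (hp : 3.5389 ≤ p ∧ p ≤ 3.53893) (hq : 2.66302 ≤ q ∧ q ≤ 2.66303)
    (hμ : 1.1349 ≤ μ ∧ μ ≤ 1.1581) {κ ν : ℝ} (hκ : μ = q * κ) (hν : ν = p * κ)
    (h : Set.Icc 0.003 (1 + ν - 0.003) ⊆ nearSum p q ν ε) :
    Set.Icc 0.003 0.707 ⊆ nearSum p q μ (ε / p) ∧
      Set.Icc 0.719 (1 + μ - 0.719) ⊆ nearSum p q μ (ε / p) := by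
  obtain ⟨hp1, hp2⟩ := hp
  obtain ⟨hq1, hq2⟩ := hq
  obtain ⟨hμ1, hμ2⟩ := hμ
  have hp0 : 1 < p := by linarith
  have hq0 : 1 < q := by linarith
  subst hν hκ
  have k1 : 0.42616 ≤ κ := by nlinarith
  have k2 : κ ≤ 0.4349 := by nlinarith
  have k3 : 2.66302 * κ ≤ q * κ := by gcongr
  have k4 : q * κ ≤ 2.66303 * κ := by gcongr
  have a1 : Set.Icc 0.001 (0.2815 + κ) ⊆ nearSum p q κ (ε / p) :=
    Icc_first_low hp0 h (by linarith) (by linarith)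
  have a2 : Set.Icc 0.7184 (0.999 + κ) ⊆ nearSum p q κ (ε / p) :=
    Icc_first_high hp0 h (by linarith) (by linarith)
  refine ⟨Icc_second_low hq0 a1 (by norm_num) (by linarith), ?_⟩
  -- Central piece: the upper piece of the low copy meets the lower piece of the high copy.
  exact Icc_subset_glue (y := 0.999 + κ) (y' := 0.001 + κ * (q - 1))
    (Icc_second_low hq0 a2 (by norm_num) le_rfl)
    (Icc_second_high hq0 a1 le_rfl (by linarith)) (by linarith)

/-- Two renormalization steps later there are two holes on each side. -/
lemma two_holes (hp : 3.5389 ≤ p ∧ p ≤ 3.53893) (hq : 2.66302 ≤ q ∧ q ≤ 2.66303)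
    (hμ : 1.1349 ≤ μ ∧ μ ≤ 1.1581) {ν : ℝ} (hν : q * μ = p * ν)
    (h₁ : Set.Icc 0.003 0.707 ⊆ nearSum p q μ ε)
    (h₂ : Set.Icc 0.719 (1 + μ - 0.719) ⊆ nearSum p q μ ε) :
    Set.Icc 0.001 0.1997 ⊆ nearSum p q ν (ε / p) ∧
      Set.Icc 0.2032 (0.0794 + 0.3755 * ν) ⊆ nearSum p q ν (ε / p) ∧
      Set.Icc (0.0828 + 0.37552 * ν) (1 + ν - (0.0828 + 0.37552 * ν)) ⊆
        nearSum p q ν (ε / p) := by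
  obtain ⟨hp1, hp2⟩ := hp
  obtain ⟨hq1, hq2⟩ := hq
  obtain ⟨hμ1, hμ2⟩ := hμ
  have hp0 : 1 < p := by linarith
  have hq0 : 1 < q := by linarith
  have k1 : 2.66302 * μ ≤ q * μ := by gcongr
  have k2 : q * μ ≤ 2.66303 * μ := by gcongr
  have k3 : 0.854 ≤ ν := by nlinarith
  have k4 : ν ≤ 0.8715 := by nlinarith
  have k5 : 3.5389 * ν ≤ p * ν := by gcongr
  have k6 : p * ν ≤ 3.53893 * ν := by gcongr
  have g1 : Set.Icc 0.003 0.707 ⊆ nearSum p q (p * ν) ε :=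
    hν ▸ Icc_second_low hq0 h₁ le_rfl le_rfl
  have g2 : Set.Icc 0.719 (1 + μ - 0.719) ⊆ nearSum p q (p * ν) ε :=
    hν ▸ Icc_second_low hq0 h₂ le_rfl le_rfl
  have g3 : Set.Icc (μ + 0.293) (p * ν - μ + 0.707) ⊆ nearSum p q (p * ν) ε := by
    rw [← hν]
    refine Icc_subset_glue (y := 1 + μ - 0.003) (y' := 0.003 + μ * (q - 1))
      (Icc_second_low hq0 (Icc_symm hp0 hq0 h₁ le_rfl le_rfl) (by linarith) le_rfl)
      (Icc_second_high hq0 h₁ le_rfl (by linarith)) (by linarith)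
  have g4 : Set.Icc (p * ν - μ + 0.719) (1 + p * ν - 0.719) ⊆ nearSum p q (p * ν) ε :=
    Icc_symm hp0 hq0 g2 (by linarith) (by linarith)
  -- Endpoints involving `μ = p * ν / q` become multiples of `ν / q`; 0.3755 and 0.37552 bracket `1
  -- / q`.
  refine ⟨Icc_first_low hp0 g1 (by linarith) (by linarith),
    Icc_first_low hp0 g2 (by linarith) (by linarith),
    Icc_symm_glue (y := 0.0792 + ν) hp0 hq0 ?_ (by linarith)⟩
  have a1 : Set.Icc (0.0828 + 0.37552 * ν) 0.733 ⊆ nearSum p q ν (ε / p) :=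
    Icc_first_low hp0 g3 (by linarith) (by linarith)
  -- This high copy fills the hole between `g3` and `g4`.
  have a2 : Set.Icc 0.72 0.917 ⊆ nearSum p q ν (ε / p) :=
    Icc_first_high hp0 g1 (by linarith) (by linarith)
  have a3 : Set.Icc 0.748 (0.0792 + ν) ⊆ nearSum p q ν (ε / p) :=
    Icc_first_low hp0 g4 (by linarith) (by linarith)
  exact Icc_subset_glue (Icc_subset_glue a1 a2 (by norm_num)) a3 (by norm_num)

/-- Overlaps fill all holes except two near each end, now closer to it; 0.141 and 0.14102 bracket `1
/ q ^ 2`. -/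
lemma two_holes_first (hp : 3.5389 ≤ p ∧ p ≤ 3.53893) (hq : 2.66302 ≤ q ∧ q ≤ 2.66303)
    (hμ : 0.854 ≤ μ ∧ μ ≤ 0.8715) {ν : ℝ} (hν : q * μ = p * ν) (hν₀ : 0.6426 ≤ ν)
    (h₁ : Set.Icc 0.001 0.1997 ⊆ nearSum p q μ ε)
    (h₂ : Set.Icc 0.2032 (0.0794 + 0.3755 * μ) ⊆ nearSum p q μ ε)
    (h₃ : Set.Icc (0.0828 + 0.37552 * μ) (1 + μ - (0.0828 + 0.37552 * μ)) ⊆ nearSum p q μ ε) :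
    Set.Icc 0.0003 0.0564 ⊆ nearSum p q ν (ε / p) ∧
      Set.Icc 0.0575 (0.0224 + 0.141 * ν) ⊆ nearSum p q ν (ε / p) ∧
      Set.Icc (0.0234 + 0.14102 * ν) (1 + ν - (0.0234 + 0.14102 * ν)) ⊆
        nearSum p q ν (ε / p) := by
  obtain ⟨hp1, hp2⟩ := hp
  obtain ⟨hq1, hq2⟩ := hq
  obtain ⟨hμ1, hμ2⟩ := hμ
  have hp0 : 1 < p := by linarith
  have hq0 : 1 < q := by linarith
  have k1 : 2.66302 * μ ≤ q * μ := by gcongr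
  have k2 : q * μ ≤ 2.66303 * μ := by gcongr
  have k4 : ν ≤ 0.6559 := by nlinarith
  have k5 : 3.5389 * ν ≤ p * ν := by gcongr
  have k6 : p * ν ≤ 3.53893 * ν := by gcongr
  have g1 : Set.Icc 0.001 0.1997 ⊆ nearSum p q (p * ν) ε :=
    hν ▸ Icc_second_low hq0 h₁ le_rfl le_rfl
  have g2 : Set.Icc 0.2032 (0.0794 + 0.3755 * μ) ⊆ nearSum p q (p * ν) ε :=
    hν ▸ Icc_second_low hq0 h₂ le_rfl le_rfl
  have g3 : Set.Icc (0.0828 + 0.37552 * μ) (1 + p * ν - (0.0828 + 0.37552 * μ)) ⊆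
      nearSum p q (p * ν) ε := by
    refine Icc_symm_glue (y := 1 + μ - 0.2032) hp0 hq0 ?_ (by linarith)
    rw [← hν]
    have a1 := Icc_second_low hq0 h₃ le_rfl le_rfl
    -- The first piece of the high copy fills the hole between `h₃` and the mirror image of `h₂`.
    have a2 := Icc_second_high hq0 h₁ le_rfl le_rfl
    have a3 := Icc_second_low hq0 (Icc_symm hp0 hq0 h₂ le_rfl le_rfl) le_rfl le_rfl
    exact Icc_subset_glue (Icc_subset_glue a1 a2 (by linarith)) a3 (by linarith)
  refine ⟨Icc_first_low hp0 g1 (by linarith) (by linarith),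
    Icc_first_low hp0 g2 (by linarith) (by linarith),
    Icc_symm_glue (y := 0.7397 + 0.141 * ν) hp0 hq0 ?_ (by linarith)⟩
  have a1 : Set.Icc (0.0234 + 0.14102 * ν) (0.259 + 0.85898 * ν) ⊆ nearSum p q ν (ε / p) :=
    Icc_first_low hp0 g3 (by linarith) (by linarith)
  have a2 : Set.Icc 0.775 (0.7397 + 0.141 * ν) ⊆ nearSum p q ν (ε / p) :=
    Icc_first_high hp0 g2 (by linarith) (by linarith)
  exact Icc_subset_glue a1 a2 (by linarith)

/-- After contraction both holes at each end lie inside the margin 0.033, and the high copy of `h₁`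
carries the interval past the centre. -/
lemma trimmed_of_two_holes (hp : 3.5389 ≤ p ∧ p ≤ 3.53893) (hq : 2.66302 ≤ q ∧ q ≤ 2.66303)
    (hμ : 0.6426 ≤ μ ∧ μ ≤ 0.6559) {ν : ℝ} (hν : q * μ = p * ν)
    (h₁ : Set.Icc 0.0575 (0.0224 + 0.141 * μ) ⊆ nearSum p q μ ε)
    (h₂ : Set.Icc (0.0234 + 0.14102 * μ) (1 + μ - (0.0234 + 0.14102 * μ)) ⊆ nearSum p q μ ε) :
    Set.Icc 0.033 (1 + ν - 0.033) ⊆ nearSum p q ν (ε / p) := by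
  obtain ⟨hp1, hp2⟩ := hp
  obtain ⟨hq1, hq2⟩ := hq
  obtain ⟨hμ1, hμ2⟩ := hμ
  have hp0 : 1 < p := by linarith
  have hq0 : 1 < q := by linarith
  have k1 : 2.66302 * μ ≤ q * μ := by gcongr
  have k2 : q * μ ≤ 2.66303 * μ := by gcongr
  have k4 : ν ≤ 0.4937 := by nlinarith
  have g1 : Set.Icc 0.0575 (0.0224 + 0.141 * μ) ⊆ nearSum p q (p * ν) ε :=
    hν ▸ Icc_second_low hq0 h₁ le_rfl le_rfl
  have g2 : Set.Icc (0.0234 + 0.14102 * μ) (1 + p * ν - (0.0234 + 0.14102 * μ)) ⊆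
      nearSum p q (p * ν) ε := by
    refine Icc_symm_glue (y := 1 + μ - (0.0234 + 0.14102 * μ)) hp0 hq0 ?_ (by linarith)
    exact hν ▸ Icc_second_low hq0 h₂ le_rfl le_rfl
  refine Icc_symm_glue (y := 0.749) hp0 hq0 ?_ (by linarith)
  have a1 : Set.Icc 0.033 0.7337 ⊆ nearSum p q ν (ε / p) :=
    Icc_first_low hp0 g2 (by linarith) (by linarith)
  have a2 : Set.Icc 0.7337 0.749 ⊆ nearSum p q ν (ε / p) :=
    Icc_first_high hp0 g1 (by linarith) (by linarith)
  exact Icc_subset_glue a1 a2 le_rfl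

end

/-! ### Intervals in the sums -/

/-- Two p-steps bring the margin from 0.033 through 0.0094 to the 0.003 required by
`pieces_of_trimmed`. -/
lemma trimmed_of_trimmed {p q ε ν₃ ν₄ ν₅ : ℝ} (hp : 3.5389 ≤ p ∧ p ≤ 3.53893)
    (hq : 2.66302 ≤ q ∧ q ≤ 2.66303) (hν : 0.4835 ≤ ν₃ ∧ ν₃ ≤ 0.4937)
    (h₁ : q * (q * ν₃) = p * ν₄) (h₂ : q * ν₄ = p * ν₅)
    (h : Set.Icc 0.033 (1 + ν₃ - 0.033) ⊆ nearSum p q ν₃ ε) :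
    Set.Icc 0.003 (1 + ν₅ - 0.003) ⊆ nearSum p q ν₅ (ε / p / p) := by
  obtain ⟨hp1, hp2⟩ := hp
  obtain ⟨hq1, hq2⟩ := hq
  obtain ⟨hν1, hν2⟩ := hν
  have hp0 : 1 < p := by linarith
  have hq0 : 1 < q := by linarith
  have mul_bounds (x : ℝ) (hx : 0 ≤ x) : 2.66302 * x ≤ q * x ∧ q * x ≤ 2.66303 * x :=
    ⟨by gcongr, by gcongr⟩
  obtain ⟨k1, k2⟩ := mul_bounds ν₃ (by linarith)
  obtain ⟨k3, k4⟩ := mul_bounds (q * ν₃) (by linarith)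
  have k5 : 0.96 ≤ ν₄ := by nlinarith
  have k6 : ν₄ ≤ 1 := by nlinarith
  obtain ⟨k7, k8⟩ := mul_bounds ν₄ (by linarith)
  have t₁ := trimmed_second hq0 h (by linarith)
  have t₂ := trimmed_second hq0 t₁ (by linarith)
  rw [h₁] at t₂
  have t₃ := trimmed_first (δ' := 0.0094) hp0 t₂ (by linarith) (by linarith)
  have t₄ := trimmed_second hq0 t₃ (by linarith)
  rw [h₂] at t₄
  exact trimmed_first (δ' := 0.003) hp0 t₄ (by linarith) (by linarith)

/-- A full cycle of renormalizations when holes occur divides the error by at least `p`. -/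
lemma holes_cycle {g p q μ ε : ℝ} (hg : g = 1.0321) (hp : p = g ^ 40) (hq : q = g ^ 31)
    (hp' : 3.5389 ≤ p ∧ p ≤ 3.53893) (hq' : 2.66302 ≤ q ∧ q ≤ 2.66303)
    (hμ : 1.1349 ≤ μ ∧ μ ≤ 1.1581)
    (h₁ : Set.Icc 0.003 0.707 ⊆ nearSum p q μ ε)
    (h₂ : Set.Icc 0.719 (1 + μ - 0.719) ⊆ nearSum p q μ ε) :
    Set.Icc 0.003 0.707 ⊆ nearSum p q μ (ε / p) ∧
      Set.Icc 0.719 (1 + μ - 0.719) ⊆ nearSum p q μ (ε / p) := by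
  have hp1 : 1 < p := by linarith [hp'.1]
  have hq1 : 1 < q := by linarith [hq'.1]
  have hg0 : 0 < g := by rw [hg]; norm_num
  have hdown {ε' ν : ℝ} : nearSum p q ν (ε' / p) ⊆ nearSum p q ν ε' :=
    fun _ hu => nearSum_div_subset hp1 hu
  have hstep (k : ℤ) : q * (μ * g ^ k) = p * (μ * g ^ (k - 9)) := by
    rw [zpow_sub₀ hg0.ne', hp, hq]
    norm_cast
    field_simp
  have e1 : q * μ = p * (μ * g ^ (-9 : ℤ)) := by simpa using hstep 0
  have e2 := hstep (-9)
  have e3 := hstep (-18)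
  norm_num only at e2 e3
  set ν₁ := μ * g ^ (-9 : ℤ)
  set ν₂ := μ * g ^ (-18 : ℤ)
  set ν₃ := μ * g ^ (-27 : ℤ) with hν₃
  obtain ⟨hp1', hp2'⟩ := id hp'
  obtain ⟨hq1', hq2'⟩ := id hq'
  obtain ⟨hμ1, hμ2⟩ := id hμ
  have b1 : 0.854 ≤ ν₁ ∧ ν₁ ≤ 0.8715 := ⟨by nlinarith, by nlinarith⟩
  obtain ⟨b11, b12⟩ := id b1
  have b2 : 0.6426 ≤ ν₂ ∧ ν₂ ≤ 0.6559 := ⟨by nlinarith, by nlinarith⟩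
  obtain ⟨b21, b22⟩ := id b2
  have b3 : 0.4835 ≤ ν₃ ∧ ν₃ ≤ 0.4937 := ⟨by nlinarith, by nlinarith⟩
  obtain ⟨i1, i2, i3⟩ := two_holes hp' hq' hμ e1 h₁ h₂
  obtain ⟨-, j2, j3⟩ := two_holes_first hp' hq' b1 e2 b2.1 i1 i2 i3
  have t₀ := trimmed_of_two_holes hp' hq' b2 e3 j2 j3
  have e4 : q * (q * ν₃) = p * (μ * g ^ (-5 : ℤ)) := by
    have : q * ν₃ = μ * g ^ (4 : ℤ) := by
      rw [hν₃, hq, show (4 : ℤ) = 31 + -27 by norm_num, zpow_add₀ hg0.ne']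
      norm_cast
      ring
    rw [this, hstep 4]
    norm_num
  have e5 := hstep (-5)
  norm_num only at e5
  have t₅ := trimmed_of_trimmed hp' hq' b3 e4 e5 t₀
  have e6 : μ = q * (μ * g ^ (-31 : ℤ)) := by
    rw [hq, zpow_neg]
    norm_cast
    field_simp
  have e7 : μ * g ^ (9 : ℤ) = p * (μ * g ^ (-31 : ℤ)) := by
    rw [hp, show (9 : ℤ) = 40 + -31 by norm_num, zpow_add₀ hg0.ne']
    norm_cast
    ring
  refine pieces_of_trimmed hp' hq' hμ e6 e7 ?_
  -- Of the 71 steps, 11 lead from exponent 0 to -14 above, 58 lead on to 9, and `pieces_of_trimmed`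
  -- makes the last two. Only the latter meet -31, hence `l = -30`.
  refine trimmed_chain (l := -30) (m := 39) (by rw [hg]; norm_num) hp hq (by linarith)
    (by norm_num) ?_ ?_ (by linarith) 58 9 (by decide) ?_
  · have : p * (μ * g ^ (-30 : ℤ)) = μ * g ^ 10 := by
      rw [hp, zpow_neg]
      norm_cast
      field_simp
    rw [this]
    have : (1.37 : ℝ) ≤ g ^ 10 := by rw [hg]; norm_num
    nlinarith
  · have h1 : g ^ (39 : ℤ) ≤ 3.429 := by rw [hg]; norm_num
    have h2 : μ * g ^ (39 : ℤ) ≤ 1.1581 * 3.429 := by gcongr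
    have h3 : μ * g ^ (39 : ℤ) * (q - 2) ≤ 1.1581 * 3.429 * (2.66303 - 2) := by
      have : 0 ≤ q - 2 := by linarith
      gcongr
    linarith
  · have : scaleStep^[58] 9 = -14 := by decide +kernel
    rw [this]
    exact ((t₅.trans hdown).trans hdown).trans ((hdown.trans hdown).trans hdown)

/-- A full cycle of renormalizations when no hole occurs divides the error by at least `p`. -/
lemma full_cycle {g p q μ ε : ℝ} (hg : 1 < g) (hp : p = g ^ 40) (hq : q = g ^ 31)
    (hp2 : 2 < p) (hq2 : 2 < q) (hμ : 0 < μ) (h1 : (p - 2) * q ≤ p * μ)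
    (h2 : μ * p * (q - 2) ≤ q * g)
    (h : Set.Icc 0 (1 + μ - 0) ⊆ nearSum p q μ ε) :
    Set.Icc 0 (1 + μ - 0) ⊆ nearSum p q μ (ε / p) := by
  have hg0 : 0 < g := by linarith
  have hl : p - 2 + 2 * 0 ≤ p * (μ * g ^ (-31 : ℤ)) := by
    have : p * (μ * g ^ (-31 : ℤ)) = p * μ / q := by
      rw [hq, zpow_neg]
      norm_cast
      ring
    rw [this, le_div_iff₀ (by linarith)]
    linarith
  have hm : μ * g ^ (39 : ℤ) * (q - 2) ≤ q * (1 - 2 * 0) := by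
    have : μ * p * (q - 2) = g * (μ * g ^ (39 : ℤ) * (q - 2)) := by
      rw [hp]
      norm_cast
      ring
    rw [this] at h2
    have := le_of_mul_le_mul_left (h2.trans_eq (mul_comm _ _)) hg0
    linarith
  have e6 : μ = q * (μ * g ^ (-31 : ℤ)) := by
    rw [hq, zpow_neg]
    norm_cast
    field_simp
  have e7 : μ * g ^ (9 : ℤ) = p * (μ * g ^ (-31 : ℤ)) := by
    rw [hp, show (9 : ℤ) = 40 + -31 by norm_num, zpow_add₀ hg0.ne']
    norm_cast
    ring
  have t₀ : Set.Icc 0 (1 + μ * g ^ (9 : ℤ) - 0) ⊆ nearSum p q (μ * g ^ (9 : ℤ)) ε := by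
    -- The remaining two of the 71 steps are done separately, to retain one factor `1 / p`.
    refine trimmed_chain (l := -31) (m := 39) hg hp hq hμ le_rfl hl hm hq2 69 9 (by decide) ?_
    have : scaleStep^[69] 9 = 0 := by decide
    rw [this]
    simpa using h
  rw [e7] at t₀
  have t₁ := trimmed_first (δ' := 0) (by linarith) t₀ (by simp) (by linarith)
  have e8 : μ * (q - 2) ≤ q := by
    have : μ * g ^ (0 : ℤ) * (q - 2) ≤ μ * g ^ (39 : ℤ) * (q - 2) := by
      have h3 : g ^ (0 : ℤ) ≤ g ^ (39 : ℤ) := zpow_le_zpow_right₀ hg.le (by norm_num)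
      have : 0 ≤ q - 2 := by linarith
      gcongr
    simp only [zpow_zero, mul_one] at this
    linarith
  have t₂ := trimmed_second (by linarith) t₁ (by
    set κ := μ * g ^ (-31 : ℤ)
    rw [e6, mul_assoc] at e8
    have := le_of_mul_le_mul_left (e8.trans_eq (mul_one q).symm) (by linarith)
    linarith)
  rwa [← e6] at t₂

lemma subset_cantorSum_of_forall {p q lam M : ℝ} (hp : 1 < p) (hq : 1 < q) {s : Set ℝ}
    (h : ∀ n : ℕ, s ⊆ nearSum p q lam (M / p ^ n)) : s ⊆ cantorSum p q lam :=
  fun _ hu => mem_cantorSum_of_forall hp hq fun n => h n hu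

lemma exists_Icc_subset_of_window {g p q μ : ℝ} (hg : g = 1.0321) (hp : p = g ^ 40)
    (hq : q = g ^ 31) (h1 : q < μ * p * (q - 2)) (h2 : μ * p * (q - 2) ≤ q * g) :
    ∃ u v : ℝ, u < v ∧ Set.Icc u v ⊆ cantorSum p q μ := by
  have hp' : 3.5389 ≤ p ∧ p ≤ 3.53893 := by rw [hp, hg]; norm_num
  have hq' : 2.66302 ≤ q ∧ q ≤ 2.66303 := by rw [hq, hg]; norm_num
  have hp0 : 1 < p := by linarith [hp'.1]
  have hq0 : 1 < q := by linarith [hq'.1]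
  have hμ1 : 1.1349 ≤ μ := by
    have e : (1.1349 : ℝ) * p * (q - 2) ≤ q := by rw [hp, hq, hg]; norm_num
    have h3 : 0 < p * (q - 2) := mul_pos (by linarith) (by linarith [hq'.1])
    refine le_of_mul_le_mul_right ?_ h3
    linarith
  -- This decides whether the copies meet in the p-step at exponent -31.
  rcases le_total ((p - 2) * q) (p * μ) with h | h
  · refine ⟨0, 1 + μ - 0, by linarith, subset_cantorSum_of_forall (M := 1 + μ) hp0 hq0
      fun n => ?_⟩
    induction n with
    | zero => exact fun u hu => mem_nearSum_of_nonneg hu.1 (by simpa using hu.2)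
    | succ n ih =>
      rw [pow_succ, ← div_div]
      exact full_cycle (by rw [hg]; norm_num) hp hq (by linarith [hp'.1]) (by linarith [hq'.1])
        (by linarith) h h2 ih
  · have hμ2 : μ ≤ 1.1581 := by
      have e : (p - 2) * q ≤ p * 1.1581 := by rw [hp, hq, hg]; norm_num
      exact le_of_mul_le_mul_left (h.trans e) (by linarith)
    have key : ∀ n : ℕ, Set.Icc 0.003 0.707 ⊆ nearSum p q μ (3 / p ^ n) ∧
        Set.Icc 0.719 (1 + μ - 0.719) ⊆ nearSum p q μ (3 / p ^ n) := by
      intro n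
      induction n with
      | zero =>
        constructor <;> intro u hu <;> refine mem_nearSum_of_nonneg ?_ ?_ <;>
          norm_num at hu ⊢ <;> linarith [hu.1, hu.2]
      | succ n ih =>
        rw [pow_succ, ← div_div]
        exact holes_cycle hg hp hq hp' hq' ⟨hμ1, hμ2⟩ ih.1 ih.2
    exact ⟨0.003, 0.707, by norm_num, subset_cantorSum_of_forall hp0 hq0 fun n => (key n).1⟩

section

variable {p q lam : ℝ}

lemma exists_Icc_subset_of_first (hp : 1 < p)
    (h : ∃ u v : ℝ, u < v ∧ Set.Icc u v ⊆ cantorSum p q (p * lam)) :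
    ∃ u v : ℝ, u < v ∧ Set.Icc u v ⊆ cantorSum p q lam := by
  obtain ⟨u, v, huv, h⟩ := h
  have hp0 : 0 < p := by linarith
  refine ⟨u / p, v / p, by gcongr, fun x hx => ?_⟩
  have := cantorSum_of_first hp (c := 0) (Or.inl rfl) (h (a := p * x)
    ⟨(div_le_iff₀' hp0).1 hx.1, (le_div_iff₀' hp0).1 hx.2⟩)
  rwa [zero_mul, add_zero, mul_div_cancel_left₀ _ hp0.ne'] at this

lemma exists_Icc_subset_of_second (hq : 1 < q)
    (h : ∃ u v : ℝ, u < v ∧ Set.Icc u v ⊆ cantorSum p q lam) :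
    ∃ u v : ℝ, u < v ∧ Set.Icc u v ⊆ cantorSum p q (q * lam) := by
  obtain ⟨u, v, huv, h⟩ := h
  exact ⟨u, v, huv, fun x hx => by
    simpa using cantorSum_of_second hq (c := 0) (Or.inl rfl) (h hx)⟩

lemma exists_Icc_subset_mul_pow {g : ℝ} (hg : 1 < g) (hp : p = g ^ 40) (hq : q = g ^ 31)
    (h : ∃ u v : ℝ, u < v ∧ Set.Icc u v ⊆ cantorSum p q lam) (k : ℤ) :
    ∃ u v : ℝ, u < v ∧ Set.Icc u v ⊆ cantorSum p q (lam * g ^ k) := by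
  have hg0 : g ≠ 0 := by linarith
  have hp1 : 1 < p := hp ▸ one_lt_pow₀ hg (by norm_num)
  have hq1 : 1 < q := hq ▸ one_lt_pow₀ hg (by norm_num)
  have hx (x : ℕ) : ∃ u v : ℝ, u < v ∧ Set.Icc u v ⊆ cantorSum p q (q ^ x * lam) := by
    induction x with
    | zero => simpa using h
    | succ x ih =>
      rw [pow_succ', mul_assoc]
      exact exists_Icc_subset_of_second hq1 ih
  have hy (y : ℕ) : ∀ lam' : ℝ,
      (∃ u v : ℝ, u < v ∧ Set.Icc u v ⊆ cantorSum p q (p ^ y * lam')) →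
      ∃ u v : ℝ, u < v ∧ Set.Icc u v ⊆ cantorSum p q lam' := by
    induction y with
    | zero => simp
    | succ y ih =>
      intro lam' h'
      refine exists_Icc_subset_of_first hp1 (ih _ ?_)
      rwa [← mul_assoc, ← pow_succ]
  -- Bézout: 31·31 - 40·24 = 1 and 31·9 - 40·7 = -1.
  obtain ⟨x, y, hxy⟩ : ∃ x y : ℕ, (31 * x : ℤ) = 40 * y + k := by
    rcases le_total 0 k with h0 | h0
    · exact ⟨31 * k.toNat, 24 * k.toNat, by omega⟩
    · exact ⟨9 * (-k).toNat, 7 * (-k).toNat, by omega⟩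
  refine hy y _ ?_
  have e : p ^ y * (lam * g ^ k) = q ^ x * lam := by
    have : g ^ (40 * y : ℤ) * g ^ k = g ^ (31 * x : ℤ) := by rw [← zpow_add₀ hg0, hxy]
    rw [zpow_mul, zpow_mul] at this
    norm_cast at this
    rw [hp, hq, mul_left_comm, this, mul_comm]
  rw [e]
  exact hx x

lemma exists_Icc_subset_cantorSum {g : ℝ} (hg : g = 1.0321) (hp : p = g ^ 40) (hq : q = g ^ 31)
    (hlam : 0 < lam) : ∃ u v : ℝ, u < v ∧ Set.Icc u v ⊆ cantorSum p q lam := by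
  have hg1 : 1 < g := by rw [hg]; norm_num
  have hp0 : 0 < p := by rw [hp]; positivity
  have hq2 : 2 < q := by rw [hq, hg]; norm_num
  have hc : 0 < p * (q - 2) := mul_pos hp0 (by linarith)
  obtain ⟨n, hn1, hn2⟩ := exists_mem_Ioc_zpow
    (div_pos (mul_pos hlam hc) (by linarith : 0 < q)) hg1
  have hgn : 0 < g ^ n := zpow_pos (by linarith) _
  rw [lt_div_iff₀ (by linarith)] at hn1
  rw [div_le_iff₀ (by linarith), zpow_add_one₀ (by linarith)] at hn2
  have e : lam / g ^ n * p * (q - 2) = lam * (p * (q - 2)) / g ^ n := by ring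
  have := exists_Icc_subset_mul_pow hg1 hp hq (exists_Icc_subset_of_window (μ := lam / g ^ n)
    hg hp hq (by rw [e, lt_div_iff₀ hgn]; linarith) (by rw [e, div_le_iff₀ hgn]; linarith)) n
  rwa [div_mul_cancel₀ _ hgn.ne'] at this

end

theorem mainTheorem2 (lam : ℝ) (hlam : lam ≠ 0) :
    ∃ u v : ℝ, u < v ∧
      Set.Icc u v ⊆
        middleCantorSet ((1.0321 : ℝ) ^ 40) - lam • middleCantorSet ((1.0321 : ℝ) ^ 31) := by
  rcases lt_or_gt_of_ne hlam with h | h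
  · obtain ⟨u, v, huv, hs⟩ := exists_Icc_subset_cantorSum rfl rfl rfl (neg_pos.2 h)
    refine ⟨u, v, huv, fun t ht => ?_⟩
    obtain ⟨x, hx, y, hy, rfl⟩ := mem_cantorSum.1 (hs ht)
    exact Set.mem_sub.2 ⟨x, hx, _, Set.smul_mem_smul_set hy, by rw [smul_eq_mul]; ring⟩
  · obtain ⟨u, v, huv, hs⟩ := exists_Icc_subset_cantorSum rfl rfl rfl h
    -- Replacing y by 1 - y turns the sum into the difference shifted by `lam`.
    refine ⟨u - lam, v - lam, by linarith, fun t ht => ?_⟩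
    obtain ⟨x, hx, y, hy, hxy⟩ := mem_cantorSum.1
      (hs (a := t + lam) ⟨by linarith [ht.1], by linarith [ht.2]⟩)
    have hq : (1 : ℝ) < 1.0321 ^ 31 := one_lt_pow₀ (by norm_num) (by norm_num)
    exact Set.mem_sub.2 ⟨x, hx, _, Set.smul_mem_smul_set (one_sub_mem_middleCantorSet hq hy),
      by rw [smul_eq_mul]; linarith⟩
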